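/- For a two-qubit state $\rho_{kl}$ (sender holding qubit $k$, receiver qubit $l$) let $C(\rho_{kl})=1+S(\rho_l)-S(\rho_{kl})$ be its dense coding capacity, where $S(\rho)=-\mathrm{Tr}(\rho\log_2\rho)$ is the von Neumann entropy and $\rho_l=\mathrm{Tr}_k\,\rho_{kl}$. For a three-qubit state $\rho_{123}$ and a permutation $(j,k,l)$ of $(1,2,3)$, the control power of the holder of qubit $j$ is $$P^{jkl}(\rho_{123})=\max_U\sum_{i=0}^{1}p_i\,C(\rho^i_{kl})-C(\rho_{kl}),\qquad p_i=\langle i|U\rho_jU^\dagger|i\rangle ,$$ where the maximum is over all $2\times2$ unitary matrices $U$, $\rho_j$ and $\rho_{kl}$ are the reduced states of $\rho_{123}$, and $\rho^i_{kl}=\langle i|U_j\,\rho_{123}\,U_j^\dagger|i\rangle_j/p_i$ is the state of qubits $k,l$ after outcome $i$ of the measurement of qubit $j$ in the basis given by $U$, with $U_j$ denoting $U$ acting on qubit $j$ (outcomes with $p_i=0$ contribute $0$). The minimal control power is $P(\rho_{123})=\min_{(j,k,l)}P^{jkl}(\rho_{123})$, the minimum over all six permutations. Proposition. Let $\rho_{123}$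 be a pure three-qubit state. Then $P(\rho_{123})=1$ if and only if $\rho_{123}$ is, up to local unitaries, the standard GHZ state, i.e. if and only if there are $2\times 2$ unitary matrices $U_1,U_2,U_3$ with $$\rho_{123}=(U_1\otimes U_2\otimes U_3)\,|\mathrm{GHZ}\rangle\langle \mathrm{GHZ}|\,(U_1\otimes U_2\otimes U_3)^\dagger,\qquad |\mathrm{GHZ}\rangle=\frac{|000\rangle+|111\rangle}{\sqrt2}.$$ -/

import Mathlib

open scoped Matrix Kronecker ComplexOrder

noncomputable section

namespace ControlledDenseCoding

/-- Pure states `|ψ⟩⟨ψ|` with `ψ` a unit vector. -/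
def IsPureState {n : Type*} [Fintype n] (ρ : Matrix n n ℂ) : Prop :=
  ∃ ψ : n → ℂ, ∑ i, ‖ψ i‖ ^ 2 = 1 ∧ ρ = Matrix.vecMulVec ψ (star ψ)

/-- The von Neumann entropy `S(ρ) = - Tr (ρ log₂ ρ)` in bits, where `- x log₂ x` is applied to the
Hermitian matrix `ρ` by functional calculus (and `0 log₂ 0 = 0`). -/
def entropy {n : Type*} [Fintype n] [DecidableEq n] (ρ : Matrix n n ℂ) : ℝ :=
  (cfc (fun x : ℝ => -(x * Real.logb 2 x)) ρ).trace.re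

/-- Partial trace over the first tensor factor. -/
def traceFst {m n : Type*} [Fintype m] (ρ : Matrix (m × n) (m × n) ℂ) : Matrix n n ℂ :=
  Matrix.of fun x y => ∑ a, ρ (a, x) (a, y)

/-- Partial trace over the second tensor factor. -/
def traceSnd {m n : Type*} [Fintype n] (ρ : Matrix (m × n) (m × n) ℂ) : Matrix m m ℂ :=
  Matrix.of fun a b => ∑ x, ρ (a, x) (b, x)

/-- The dense coding channel capacity `1 + S(ρ_l) - S(ρ_kl)` of a two-qubit state; the sender holds
the first tensor factor and the receiver the second. -/
def capacity (ρ : Matrix (Fin 2 × Fin 2) (Fin 2 × Fin 2) ℂ) : ℝ :=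
  1 + entropy (traceFst ρ) - entropy ρ

/-- Operators on three qubits. The computational basis vector `|f 0, f 1, f 2⟩` is indexed by
`f : Fin 3 → Fin 2`. -/
abbrev ThreeQubitOp := Matrix (Fin 3 → Fin 2) (Fin 3 → Fin 2) ℂ

/-- Operators on the tensor product of Charlie's qubit with Alice's and Bob's qubits. -/
abbrev CharlieAliceBobOp := Matrix (Fin 2 × (Fin 2 × Fin 2)) (Fin 2 × (Fin 2 × Fin 2)) ℂ

/-- Distribution of the three qubits: Charlie gets qubit `j = σ 0`, Alice `k = σ 1`, and
Bob `l = σ 2`. -/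
def distribute (σ : Equiv.Perm (Fin 3)) (ρ : ThreeQubitOp) : CharlieAliceBobOp :=
  ρ.submatrix (fun p i => ![p.1, p.2.1, p.2.2] (σ.symm i))
    (fun p i => ![p.1, p.2.1, p.2.2] (σ.symm i))

/-- The probability `⟨i|U ρ_j U†|i⟩` of Charlie's outcome `i`. -/
def outcomeProb (U : Matrix.unitaryGroup (Fin 2) ℂ) (ρ : CharlieAliceBobOp) (i : Fin 2) : ℝ :=
  ((U : Matrix (Fin 2) (Fin 2) ℂ) * traceSnd ρ * (U : Matrix (Fin 2) (Fin 2) ℂ)ᴴ) i i |>.re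

/-- The unnormalised state `⟨i|(U ⊗ 1) ρ (U ⊗ 1)†|i⟩` of Alice and Bob after the outcome `i`. -/
def unnormalizedPostState (U : Matrix.unitaryGroup (Fin 2) ℂ) (ρ : CharlieAliceBobOp) (i : Fin 2) :
    Matrix (Fin 2 × Fin 2) (Fin 2 × Fin 2) ℂ :=
  (((U : Matrix (Fin 2) (Fin 2) ℂ) ⊗ₖ (1 : Matrix (Fin 2 × Fin 2) (Fin 2 × Fin 2) ℂ)) * ρ *
    ((U : Matrix (Fin 2) (Fin 2) ℂ) ⊗ₖ (1 : Matrix (Fin 2 × Fin 2) (Fin 2 × Fin 2) ℂ))ᴴ).submatrix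
      (fun x => (i, x)) (fun x => (i, x))

/-- The state `ρ_kl^i` that Alice and Bob share after Charlie's outcome `i` (relevant only if the
outcome has positive probability; otherwise it enters with weight zero below). -/
def postState (U : Matrix.unitaryGroup (Fin 2) ℂ) (ρ : CharlieAliceBobOp) (i : Fin 2) :
    Matrix (Fin 2 × Fin 2) (Fin 2 × Fin 2) ℂ :=
  (outcomeProb U ρ i)⁻¹ • unnormalizedPostState U ρ i

/-- Average capacity when Charlie measures in the basis given by `U`. -/
def averageCapacity (U : Matrix.unitaryGroup (Fin 2) ℂ) (ρ : CharlieAliceBobOp) : ℝ :=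
  ∑ i, outcomeProb U ρ i * capacity (postState U ρ i)

/-- The controlled dense coding capacity: the largest average capacity over all measurement bases.
The lemma `exists_isMaxOn_averageCapacity` shows that for states the supremum is a maximum. -/
def controlledCapacity (ρ : CharlieAliceBobOp) : ℝ :=
  ⨆ U : Matrix.unitaryGroup (Fin 2) ℂ, averageCapacity U ρ

/-- The control power of Charlie for the distribution `σ = (j, k, l)` of the qubits. -/
def controlPower (σ : Equiv.Perm (Fin 3)) (ρ : ThreeQubitOp) : ℝ :=
  controlledCapacity (distribute σ ρ) - capacity (traceFst (distribute σ ρ))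

/-- The minimal control power: the minimum over all six distributions of the qubits. -/
def minimalControlPower (ρ : ThreeQubitOp) : ℝ :=
  Finset.univ.inf' Finset.univ_nonempty fun σ : Equiv.Perm (Fin 3) => controlPower σ ρ

/-- The vector `(|000⟩ + |111⟩)/√2`. -/
def ghzVector : (Fin 3 → Fin 2) → ℂ :=
  ((1 / Real.sqrt 2 : ℝ) : ℂ) • (Pi.single (fun _ => 0) 1 + Pi.single (fun _ => 1) 1)

/-- The standard GHZ state. -/
def ghzState : ThreeQubitOp := Matrix.vecMulVec ghzVector (star ghzVector)

/-- The local unitary `U 0 ⊗ U 1 ⊗ U 2`. -/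
def localUnitary (U : Fin 3 → Matrix.unitaryGroup (Fin 2) ℂ) : ThreeQubitOp :=
  Matrix.of fun f g => ∏ i, (U i : Matrix (Fin 2) (Fin 2) ℂ) (f i) (g i)




/-! ### The supremum in `controlledCapacity` is attained -/

section Attainment

lemma continuous_neg_mul_logb : Continuous fun x : ℝ => -(x * Real.logb 2 x) := by
  have h := (Real.continuous_mul_log.div_const (Real.log 2)).neg
  refine h.congr fun x => ?_
  simp only [Pi.neg_apply, Real.logb, mul_div_assoc]

open scoped Matrix.Norms.L2Operator in
lemma continuous_entropy_comp {X n : Type*} [TopologicalSpace X] [Fintype n] [DecidableEq n]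
    (a : X → Matrix n n ℂ) (ha : Continuous a) (hh : ∀ x, (a x).IsHermitian) :
    Continuous fun x => entropy (a x) := by
  have hη := continuous_neg_mul_logb
  have h1 : Continuous fun x => cfc (fun x : ℝ => -(x * Real.logb 2 x)) (a x) :=
    Continuous.cfc_of_mem_nhdsSet (s := Set.univ) _ Filter.univ_mem ha
      (fun x => (hh x).isSelfAdjoint) hη.continuousOn
  exact Complex.continuous_re.comp h1.matrix_trace

lemma mul_entropy_inv_smul {n : Type*} [Fintype n] [DecidableEq n] (A : Matrix n n ℂ)
    (hA : A.IsHermitian) (r : ℝ) (hr : r ≠ 0) :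
    r * entropy (r⁻¹ • A) = entropy A + Real.logb 2 r * A.trace.re := by
  have hs : IsSelfAdjoint A := hA.isSelfAdjoint
  have hη := continuous_neg_mul_logb
  have h1 : r • cfc (fun x : ℝ => -(x * Real.logb 2 x)) (r⁻¹ • A) =
      cfc (fun x : ℝ => -(x * Real.logb 2 x)) A + Real.logb 2 r • A := by
    rw [← cfc_comp_const_mul r⁻¹ _ A hη.continuousOn hs, ← cfc_const_mul_id (Real.logb 2 r) A hs,
      ← cfc_const_mul r _ A
        (show Continuous fun x : ℝ => -(r⁻¹ * x * Real.logb 2 (r⁻¹ * x)) from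
          hη.comp (continuous_const_mul r⁻¹)).continuousOn,
      ← cfc_add (a := A) _ _ hη.continuousOn (by fun_prop)]
    congr 1
    funext x
    rcases eq_or_ne x 0 with rfl | hx
    · simp
    · rw [Real.logb_mul (inv_ne_zero hr) hx, Real.logb_inv]
      field_simp
      ring
  have h2 := congrArg (fun M : Matrix n n ℂ => M.trace.re) h1
  simpa [entropy, Matrix.trace_smul, Matrix.trace_add] using h2

lemma traceFst_smul {m n : Type*} [Fintype m] (r : ℝ) (A : Matrix (m × n) (m × n) ℂ) :
    traceFst (r • A) = r • traceFst A := by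
  ext x y
  simp [traceFst, Finset.mul_sum]

lemma trace_traceFst {m n : Type*} [Fintype m] [Fintype n] (A : Matrix (m × n) (m × n) ℂ) :
    (traceFst A).trace = A.trace := by
  simp only [traceFst, Matrix.trace, Matrix.diag, Matrix.of_apply, Fintype.sum_prod_type]
  exact Finset.sum_comm

lemma isHermitian_traceFst {m n : Type*} [Fintype m] (A : Matrix (m × n) (m × n) ℂ)
    (hA : A.IsHermitian) : (traceFst A).IsHermitian := by
  ext x y
  simp [traceFst, Matrix.conjTranspose_apply, fun a b => hA.apply a b]

lemma trace_unnormalizedPostState (U : Matrix.unitaryGroup (Fin 2) ℂ) (ρ : CharlieAliceBobOp)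
    (i : Fin 2) : (unnormalizedPostState U ρ i).trace.re = outcomeProb U ρ i := by
  rw [outcomeProb]
  congr 1
  simp only [unnormalizedPostState, traceSnd, Matrix.trace, Matrix.diag, Matrix.submatrix_apply,
    Matrix.mul_apply, Matrix.of_apply, Matrix.conjTranspose_apply, Fintype.sum_prod_type,
    Matrix.kroneckerMap_apply, Fin.sum_univ_two, Matrix.one_apply]
  simp
  ring

lemma posSemidef_unnormalizedPostState (U : Matrix.unitaryGroup (Fin 2) ℂ)
    (ρ : CharlieAliceBobOp) (hρ : ρ.PosSemidef) (i : Fin 2) :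
    (unnormalizedPostState U ρ i).PosSemidef :=
  (hρ.mul_mul_conjTranspose_same _).submatrix _

lemma outcomeProb_mul_capacity (U : Matrix.unitaryGroup (Fin 2) ℂ) (ρ : CharlieAliceBobOp)
    (hρ : ρ.PosSemidef) (i : Fin 2) :
    outcomeProb U ρ i * capacity (postState U ρ i) =
      outcomeProb U ρ i + entropy (traceFst (unnormalizedPostState U ρ i)) -
        entropy (unnormalizedPostState U ρ i) := by
  have hA := posSemidef_unnormalizedPostState U ρ hρ i
  have ht := trace_unnormalizedPostState U ρ i
  set A := unnormalizedPostState U ρ i with hAdef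
  rcases eq_or_ne (outcomeProb U ρ i) 0 with h0 | h0
  · have htr : A.trace = 0 := by
      have := hA.trace_nonneg
      apply Complex.ext
      · simpa [h0] using ht
      · simpa using ((Complex.le_def.1 this).2).symm
    have hz : A = 0 := hA.trace_eq_zero_iff.1 htr
    have hz' : traceFst A = 0 := by
      rw [hz]; ext; simp [traceFst]
    rw [hz', hz, h0]
    simp [entropy, cfc_apply_zero]
  · have h1 := mul_entropy_inv_smul A hA.isHermitian _ h0
    have h2 := mul_entropy_inv_smul (traceFst A) (isHermitian_traceFst A hA.isHermitian) _ h0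
    rw [trace_traceFst] at h2
    rw [capacity, postState, ← hAdef, traceFst_smul, mul_sub, mul_add, h1, h2]
    ring

lemma continuous_averageCapacity (ρ : CharlieAliceBobOp) (hρ : ρ.PosSemidef) :
    Continuous fun U => averageCapacity U ρ := by
  unfold averageCapacity
  refine continuous_finsetSum _ fun i _ => ?_
  simp_rw [fun U => outcomeProb_mul_capacity U ρ hρ i]
  have hU : Continuous fun U : Matrix.unitaryGroup (Fin 2) ℂ =>
      unnormalizedPostState U ρ i := by
    unfold unnormalizedPostState
    refine continuous_matrix fun x y => ?_
    simp only [Matrix.submatrix_apply, Matrix.mul_apply, Matrix.conjTranspose_apply,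
      Matrix.kroneckerMap_apply]
    have : ∀ a b, Continuous fun U : Matrix.unitaryGroup (Fin 2) ℂ =>
      (U : Matrix (Fin 2) (Fin 2) ℂ) a b := fun a b => continuous_subtype_val.matrix_elem a b
    refine continuous_finsetSum _ fun j _ => Continuous.mul
      (continuous_finsetSum _ fun k _ => ((this _ _).mul continuous_const).mul continuous_const) ?_
    exact ((this _ _).mul continuous_const).star
  have hT : Continuous fun U : Matrix.unitaryGroup (Fin 2) ℂ =>
      traceFst (unnormalizedPostState U ρ i) := by
    refine continuous_matrix fun x y => ?_
    simp only [traceFst, Matrix.of_apply]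
    exact continuous_finsetSum _ fun a _ => hU.matrix_elem _ _
  have hp : Continuous fun U : Matrix.unitaryGroup (Fin 2) ℂ => outcomeProb U ρ i := by
    simp_rw [← fun U => trace_unnormalizedPostState U ρ i]
    exact Complex.continuous_re.comp hU.matrix_trace
  have hH := fun U => (posSemidef_unnormalizedPostState U ρ hρ i).isHermitian
  exact (hp.add (continuous_entropy_comp _ hT fun U => isHermitian_traceFst _ (hH U))).sub
    (continuous_entropy_comp _ hU hH)

lemma compactSpace_unitaryGroup : CompactSpace (Matrix.unitaryGroup (Fin 2) ℂ) := by
  refine isCompact_iff_compactSpace.1 ?_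
  have hK : IsCompact (Set.univ.pi fun _ : Fin 2 => Set.univ.pi fun _ : Fin 2 =>
      Metric.closedBall (0 : ℂ) 1) :=
    isCompact_univ_pi fun _ => isCompact_univ_pi fun _ => isCompact_closedBall 0 1
  refine IsCompact.of_isClosed_subset (X := Matrix (Fin 2) (Fin 2) ℂ) hK (isClosed_unitary) ?_
  intro U hU i _ j _
  simpa using entry_norm_bound_of_unitary hU i j

/-- For a positive semidefinite `ρ`, in particular for a state, some measurement basis attains the
maximal average capacity. -/
theorem exists_isMaxOn_averageCapacity (ρ : CharlieAliceBobOp) (hρ : ρ.PosSemidef) :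
    ∃ U, IsGreatest (Set.range fun V => averageCapacity V ρ) (averageCapacity U ρ) ∧
      controlledCapacity ρ = averageCapacity U ρ := by
  have := compactSpace_unitaryGroup
  obtain ⟨U, -, hU⟩ := isCompact_univ.exists_isMaxOn Set.univ_nonempty
    (continuous_averageCapacity ρ hρ).continuousOn
  have hg : IsGreatest (Set.range fun V => averageCapacity V ρ) (averageCapacity U ρ) :=
    ⟨⟨U, rfl⟩, by rintro _ ⟨V, rfl⟩; exact hU (Set.mem_univ V)⟩
  exact ⟨U, hg, hg.csSup_eq⟩

end Attainment

end ControlledDenseCoding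

end

/-! For a pure state the bipartite entropy `S(ρ_kl)` equals `S(ρ_j)`, so the control powers of
the distributions `(j, k, l)` and `(l, k, j)` add up to the two controlled capacities minus `2`.
A controlled capacity is at most `2`, with equality iff some measurement leaves Alice and Bob
maximally entangled after every outcome. If both control powers are at least `1`, both
capacities are therefore `2`, and averaging over the outcomes shows that `ρ_j` and `ρ_l` are
maximally mixed. As `ρ_j` is maximally mixed, the two outcomes are equally likely and leave
states whose amplitude matrices are multiples of unitaries `X₀`, `X₁` with `Tr (X₀ᴴ X₁) = 0`. A
traceless qubit unitary is unitarily diagonalizable with eigenvalues `e`, `-e`, so `X₀` and `X₁`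
become diagonal in common local bases, where the GHZ form can be read off. Conversely, measuring
one qubit of a GHZ state in the Hadamard basis leaves a maximally entangled pair. -/

noncomputable section

namespace ControlledDenseCoding

section Jensen

variable {ι : Type*} [Fintype ι] [Nonempty ι] {x : ι → ℝ}

lemma sum_negMulLog_le (hx : ∀ i, 0 ≤ x i) :
    ∑ i, Real.negMulLog (x i) ≤
      Fintype.card ι * Real.negMulLog ((∑ i, x i) / Fintype.card ι) := by
  have hcard : (0 : ℝ) < Fintype.card ι := Nat.cast_pos.2 Fintype.card_pos
  have h := Real.concaveOn_negMulLog.le_map_sum (t := Finset.univ) (p := x)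
    (w := fun _ => (Fintype.card ι : ℝ)⁻¹) (fun _ _ => by positivity) (by simp) fun i _ => hx i
  simp only [smul_eq_mul, ← Finset.mul_sum] at h
  rwa [inv_mul_le_iff₀ hcard, inv_mul_eq_div] at h

lemma eq_of_sum_negMulLog_eq (hx : ∀ i, 0 ≤ x i)
    (h : ∑ i, Real.negMulLog (x i) =
      Fintype.card ι * Real.negMulLog ((∑ i, x i) / Fintype.card ι)) (i : ι) :
    x i = (∑ j, x j) / Fintype.card ι := by
  have hcard : (0 : ℝ) < Fintype.card ι := Nat.cast_pos.2 Fintype.card_pos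
  have heq := Real.strictConcaveOn_negMulLog.map_sum_eq_iff (t := Finset.univ) (p := x)
    (w := fun _ => (Fintype.card ι : ℝ)⁻¹) (fun _ _ => by positivity) (by simp) fun i _ => hx i
  simp only [smul_eq_mul, ← Finset.mul_sum] at heq
  rw [eq_inv_mul_iff_mul_eq₀ hcard.ne', inv_mul_eq_div] at heq
  exact heq.1 h.symm i (Finset.mem_univ i)

lemma mul_negMulLog_div {c : ℝ} (hc : c ≠ 0) (t : ℝ) :
    c * Real.negMulLog (t / c) = Real.negMulLog t + t * Real.log c := by
  rw [div_eq_mul_inv, Real.negMulLog_mul, Real.negMulLog, Real.negMulLog, Real.log_inv]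
  field_simp

end Jensen

section Entropy

variable {m n : Type*} [Fintype m] [DecidableEq m] [Fintype n] [DecidableEq n]

lemma neg_mul_logb_two (x : ℝ) : -(x * Real.logb 2 x) = Real.negMulLog x / Real.log 2 := by
  rw [Real.negMulLog, Real.logb]
  ring

lemma entropy_eq_sum_eigenvalues {A : Matrix n n ℂ} (hA : A.IsHermitian) :
    entropy A = (∑ i, Real.negMulLog (hA.eigenvalues i)) / Real.log 2 := by
  simp_rw [entropy, hA.cfc_eq, neg_mul_logb_two, Matrix.IsHermitian.cfc,
    Unitary.conjStarAlgAut_apply]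
  rw [Matrix.trace_mul_cycle, Unitary.coe_star_mul_self, one_mul, Matrix.trace_diagonal,
    Complex.re_sum, Finset.sum_div]
  rfl

lemma entropy_eq_sum_roots {A : Matrix n n ℂ} (hA : A.IsHermitian) :
    entropy A = (A.charpoly.roots.map fun z => Real.negMulLog z.re).sum / Real.log 2 := by
  rw [entropy_eq_sum_eigenvalues hA, hA.roots_charpoly_eq_eigenvalues]
  simp

lemma entropy_transpose {A : Matrix n n ℂ} (hA : A.IsHermitian) : entropy Aᵀ = entropy A := by
  rw [entropy_eq_sum_roots hA, entropy_eq_sum_roots hA.transpose, Matrix.charpoly_transpose]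

-- The two products have the same characteristic roots up to zeros, and zeros have no entropy.
lemma entropy_mul_conjTranspose_comm (M : Matrix m n ℂ) : entropy (M * Mᴴ) = entropy (Mᴴ * M) := by
  have hroots := congrArg Polynomial.roots (Matrix.charpoly_mul_comm' M Mᴴ)
  have hX (k : ℕ) {p : Polynomial ℂ} (hp : p.Monic) :
      (Polynomial.X ^ k * p).roots = k • {0} + p.roots := by
    rw [Polynomial.roots_mul ((Polynomial.monic_X_pow k).mul hp).ne_zero, Polynomial.roots_X_pow]
  rw [hX _ (Matrix.charpoly_monic _), hX _ (Matrix.charpoly_monic _)] at hroots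
  rw [entropy_eq_sum_roots (Matrix.isHermitian_mul_conjTranspose_self M),
    entropy_eq_sum_roots (Matrix.isHermitian_conjTranspose_mul_self M)]
  congr 1
  simpa [Multiset.map_nsmul, Multiset.sum_nsmul] using congrArg
    (fun s => (s.map fun z : ℂ => Real.negMulLog z.re).sum) hroots

lemma entropy_smul_one (c : ℝ) :
    entropy (c • (1 : Matrix n n ℂ)) = Fintype.card n * Real.negMulLog c / Real.log 2 := by
  rw [← Algebra.algebraMap_eq_smul_one, entropy, cfc_algebraMap, neg_mul_logb_two,
    Algebra.algebraMap_eq_smul_one, Matrix.trace_smul, Matrix.trace_one, Complex.smul_re,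
    Complex.natCast_re, smul_eq_mul]
  ring

lemma sum_eigenvalues_eq_trace_re {A : Matrix n n ℂ} (hA : A.IsHermitian) :
    ∑ i, hA.eigenvalues i = A.trace.re := by
  rw [hA.trace_eq_sum_eigenvalues, Complex.re_sum]
  rfl

lemma eq_smul_one_of_eigenvalues_eq {A : Matrix n n ℂ} (hA : A.IsHermitian) {c : ℝ}
    (h : ∀ i, hA.eigenvalues i = c) : A = c • 1 := by
  have hspec : (spectrum ℝ A).EqOn id fun _ => c := by
    rw [hA.spectrum_real_eq_range_eigenvalues]
    rintro _ ⟨i, rfl⟩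
    exact h i
  rw [← Algebra.algebraMap_eq_smul_one, ← cfc_const c A hA.isSelfAdjoint, ← cfc_congr hspec,
    cfc_id ℝ A hA.isSelfAdjoint]

lemma entropy_le [Nonempty n] {A : Matrix n n ℂ} (hA : A.PosSemidef) :
    entropy A ≤ Real.negMulLog A.trace.re / Real.log 2 +
      A.trace.re * Real.logb 2 (Fintype.card n) := by
  rw [entropy_eq_sum_eigenvalues hA.isHermitian, Real.logb, ← mul_div_assoc, ← add_div,
    ← mul_negMulLog_div (Nat.cast_ne_zero.2 Fintype.card_ne_zero),
    ← sum_eigenvalues_eq_trace_re hA.isHermitian]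
  gcongr
  exact sum_negMulLog_le hA.eigenvalues_nonneg

lemma entropy_eq_iff [Nonempty n] {A : Matrix n n ℂ} (hA : A.PosSemidef) :
    entropy A = Real.negMulLog A.trace.re / Real.log 2 +
      A.trace.re * Real.logb 2 (Fintype.card n) ↔ A = (A.trace.re / Fintype.card n) • 1 := by
  rw [Real.logb, ← mul_div_assoc, ← add_div,
    ← mul_negMulLog_div (Nat.cast_ne_zero.2 Fintype.card_ne_zero)]
  refine ⟨fun h => eq_smul_one_of_eigenvalues_eq hA.isHermitian ?_, fun h => ?_⟩
  · rw [entropy_eq_sum_eigenvalues hA.isHermitian, div_left_inj' (Real.log_pos one_lt_two).ne',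
      ← sum_eigenvalues_eq_trace_re hA.isHermitian] at h
    rw [← sum_eigenvalues_eq_trace_re hA.isHermitian]
    exact eq_of_sum_negMulLog_eq hA.eigenvalues_nonneg h
  · conv_lhs => rw [h]
    rw [entropy_smul_one]

end Entropy

section PureStates

variable {m n : Type*}

/-- The operator `|ψ⟩⟨ψ|`: the pure state of a unit vector `ψ`, and an unnormalised pure state in
general. -/
def ketBra (ψ : n → ℂ) : Matrix n n ℂ :=
  Matrix.vecMulVec ψ (star ψ)

/-- The matrix of amplitudes of a bipartite vector, with rows indexed by the first factor. -/
def amplitudes (Ψ : m × n → ℂ) : Matrix m n ℂ :=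
  Matrix.of fun a x => Ψ (a, x)

lemma ketBra_apply (ψ : n → ℂ) (i j : n) : ketBra ψ i j = ψ i * star (ψ j) := rfl

lemma traceSnd_ketBra [Fintype n] (Ψ : m × n → ℂ) :
    traceSnd (ketBra Ψ) = amplitudes Ψ * (amplitudes Ψ)ᴴ := rfl

lemma traceFst_ketBra [Fintype m] (Ψ : m × n → ℂ) :
    traceFst (ketBra Ψ) = ((amplitudes Ψ)ᴴ * amplitudes Ψ)ᵀ := by
  ext x y
  simp only [traceFst, amplitudes, ketBra_apply, Matrix.of_apply, Matrix.transpose_apply,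
    Matrix.mul_apply, Matrix.conjTranspose_apply, mul_comm]

lemma posSemidef_traceFst_ketBra [Fintype m] [Finite n] (Ψ : m × n → ℂ) :
    (traceFst (ketBra Ψ)).PosSemidef := by
  rw [traceFst_ketBra]
  exact (Matrix.posSemidef_conjTranspose_mul_self _).transpose

lemma posSemidef_ketBra [Finite n] (ψ : n → ℂ) : (ketBra ψ).PosSemidef :=
  Matrix.posSemidef_vecMulVec_self_star ψ

variable [Fintype n]

lemma mul_ketBra_mul_conjTranspose (M : Matrix m n ℂ) (ψ : n → ℂ) :
    M * ketBra ψ * Mᴴ = ketBra (M *ᵥ ψ) := by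
  rw [ketBra, ketBra, Matrix.mul_vecMulVec, Matrix.vecMulVec_mul, ← Matrix.star_mulVec]

lemma trace_ketBra (ψ : n → ℂ) : (ketBra ψ).trace = ((∑ i, ‖ψ i‖ ^ 2 : ℝ) : ℂ) := by
  simp [Matrix.trace, ketBra_apply, Complex.mul_conj']

lemma entropy_ketBra [DecidableEq n] (ψ : n → ℂ) :
    entropy (ketBra ψ) = Real.negMulLog (ketBra ψ).trace.re / Real.log 2 := by
  have hcol : ketBra ψ = Matrix.replicateCol Unit ψ * (Matrix.replicateCol Unit ψ)ᴴ :=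
    Matrix.vecMulVec_eq Unit ψ (star ψ)
  have hscalar : (Matrix.replicateCol Unit ψ)ᴴ * Matrix.replicateCol Unit ψ =
      (ketBra ψ).trace.re • 1 := by
    ext
    simp [trace_ketBra, Matrix.mul_apply, Complex.conj_mul', ← Complex.ofReal_pow]
  rw [hcol, entropy_mul_conjTranspose_comm, ← hcol, hscalar, entropy_smul_one, Fintype.card_unit,
    Nat.cast_one, one_mul]

lemma IsPureState.posSemidef {ρ : Matrix n n ℂ} (hρ : IsPureState ρ) : ρ.PosSemidef := by
  obtain ⟨ψ, -, rfl⟩ := hρ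
  exact posSemidef_ketBra ψ

lemma entropy_traceFst_ketBra [Fintype m] [DecidableEq m] [DecidableEq n] (Ψ : m × n → ℂ) :
    entropy (traceFst (ketBra Ψ)) = entropy (traceSnd (ketBra Ψ)) := by
  rw [traceFst_ketBra, traceSnd_ketBra,
    entropy_transpose (Matrix.isHermitian_conjTranspose_mul_self _),
    entropy_mul_conjTranspose_comm]

lemma IsPureState.trace_eq_one {ρ : Matrix n n ℂ} (hρ : IsPureState ρ) : ρ.trace = 1 := by
  obtain ⟨ψ, hψ, rfl⟩ := hρ
  exact (trace_ketBra ψ).trans (by rw [hψ, Complex.ofReal_one])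

end PureStates

section Measurement

variable (U : Matrix.unitaryGroup (Fin 2) ℂ)

lemma unnormalizedPostState_apply (ρ : CharlieAliceBobOp) (i : Fin 2) (x y : Fin 2 × Fin 2) :
    unnormalizedPostState U ρ i x y =
      ((U : Matrix (Fin 2) (Fin 2) ℂ) * ρ.submatrix (·, x) (·, y) *
        (U : Matrix (Fin 2) (Fin 2) ℂ)ᴴ) i i := by
  simp [unnormalizedPostState, Matrix.mul_apply, Matrix.one_apply, apply_ite (starRingEnd ℂ),
    Fintype.sum_prod_type (α₁ := Fin 2) (α₂ := Fin 2 × Fin 2), -Fin.sum_univ_two]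

lemma sum_unnormalizedPostState (ρ : CharlieAliceBobOp) :
    ∑ i, unnormalizedPostState U ρ i = traceFst ρ := by
  ext x y
  calc (∑ i, unnormalizedPostState U ρ i) x y
      = ((U : Matrix (Fin 2) (Fin 2) ℂ) * ρ.submatrix (·, x) (·, y) *
          (U : Matrix (Fin 2) (Fin 2) ℂ)ᴴ).trace := by
        simp only [Matrix.sum_apply, unnormalizedPostState_apply, Matrix.trace, Matrix.diag]
    _ = (ρ.submatrix (·, x) (·, y)).trace := by
        rw [Matrix.trace_mul_cycle, ← Matrix.star_eq_conjTranspose, Unitary.coe_star_mul_self,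
          one_mul]
    _ = traceFst ρ x y := rfl

lemma sum_outcomeProb (ρ : CharlieAliceBobOp) : ∑ i, outcomeProb U ρ i = ρ.trace.re := by
  simp_rw [← trace_unnormalizedPostState]
  rw [← Complex.re_sum, ← Matrix.trace_sum, sum_unnormalizedPostState, trace_traceFst]

/-- The unnormalised vector `(⟨i|U ⊗ 1)|Ψ⟩` that Alice and Bob share after Charlie's outcome `i`. -/
def postVec (Ψ : Fin 2 × (Fin 2 × Fin 2) → ℂ) (i : Fin 2) : Fin 2 × Fin 2 → ℂ :=
  ((U : Matrix (Fin 2) (Fin 2) ℂ) * amplitudes Ψ) i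

lemma unnormalizedPostState_ketBra (Ψ : Fin 2 × (Fin 2 × Fin 2) → ℂ) (i : Fin 2) :
    unnormalizedPostState U (ketBra Ψ) i = ketBra (postVec U Ψ i) := by
  have hvec : ((U : Matrix (Fin 2) (Fin 2) ℂ) ⊗ₖ (1 : Matrix (Fin 2 × Fin 2) _ ℂ) *ᵥ Ψ) ∘
      (i, ·) = postVec U Ψ i := by
    ext x
    simp [postVec, amplitudes, Matrix.mulVec, dotProduct, Matrix.mul_apply, Fintype.sum_prod_type,
      Matrix.one_apply]
  rw [unnormalizedPostState, mul_ketBra_mul_conjTranspose, ← hvec]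
  rfl

end Measurement

section Capacity

variable {U : Matrix.unitaryGroup (Fin 2) ℂ} {ρ : CharlieAliceBobOp}

lemma IsPureState.outcomeProb_mul_capacity_eq (hρ : IsPureState ρ) (i : Fin 2) :
    outcomeProb U ρ i * capacity (postState U ρ i) = outcomeProb U ρ i +
      (entropy (traceFst (unnormalizedPostState U ρ i)) -
        Real.negMulLog (outcomeProb U ρ i) / Real.log 2) := by
  rw [outcomeProb_mul_capacity U ρ hρ.posSemidef]
  obtain ⟨Ψ, -, rfl⟩ := hρ
  rw [← trace_unnormalizedPostState, ← ketBra, unnormalizedPostState_ketBra, entropy_ketBra,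
    add_sub_assoc]

lemma IsPureState.posSemidef_traceFst_unnormalizedPostState (hρ : IsPureState ρ) (i : Fin 2) :
    (traceFst (unnormalizedPostState U ρ i)).PosSemidef := by
  obtain ⟨Ψ, -, rfl⟩ := hρ
  rw [← ketBra, unnormalizedPostState_ketBra]
  exact posSemidef_traceFst_ketBra _

lemma trace_traceFst_unnormalizedPostState (i : Fin 2) :
    (traceFst (unnormalizedPostState U ρ i)).trace.re = outcomeProb U ρ i := by
  rw [trace_traceFst, trace_unnormalizedPostState]

lemma IsPureState.outcomeProb_mul_capacity_le (hρ : IsPureState ρ) (i : Fin 2) :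
    outcomeProb U ρ i * capacity (postState U ρ i) ≤ 2 * outcomeProb U ρ i := by
  have h := entropy_le (hρ.posSemidef_traceFst_unnormalizedPostState (U := U) i)
  rw [trace_traceFst_unnormalizedPostState, Fintype.card_fin, Nat.cast_ofNat,
    Real.logb_self_eq_one one_lt_two, mul_one] at h
  rw [hρ.outcomeProb_mul_capacity_eq]
  linarith

lemma IsPureState.outcomeProb_mul_capacity_eq_iff (hρ : IsPureState ρ) (i : Fin 2) :
    outcomeProb U ρ i * capacity (postState U ρ i) = 2 * outcomeProb U ρ i ↔
      traceFst (unnormalizedPostState U ρ i) = (outcomeProb U ρ i / 2) • 1 := by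
  have h := entropy_eq_iff (hρ.posSemidef_traceFst_unnormalizedPostState (U := U) i)
  rw [trace_traceFst_unnormalizedPostState, Fintype.card_fin, Nat.cast_ofNat,
    Real.logb_self_eq_one one_lt_two, mul_one] at h
  rw [hρ.outcomeProb_mul_capacity_eq, ← h]
  constructor <;> intro heq <;> linarith

lemma IsPureState.sum_two_mul_outcomeProb (hρ : IsPureState ρ) :
    ∑ i, 2 * outcomeProb U ρ i = 2 := by
  rw [← Finset.mul_sum, sum_outcomeProb, hρ.trace_eq_one, Complex.one_re, mul_one]

lemma IsPureState.averageCapacity_le_two (hρ : IsPureState ρ) : averageCapacity U ρ ≤ 2 :=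
  (Finset.sum_le_sum fun i _ => hρ.outcomeProb_mul_capacity_le i).trans_eq
    hρ.sum_two_mul_outcomeProb

lemma IsPureState.averageCapacity_eq_two_iff (hρ : IsPureState ρ) :
    averageCapacity U ρ = 2 ↔
      ∀ i, traceFst (unnormalizedPostState U ρ i) = (outcomeProb U ρ i / 2) • 1 := by
  have hsum := Finset.sum_eq_sum_iff_of_le (s := Finset.univ)
    fun i _ => hρ.outcomeProb_mul_capacity_le (U := U) i
  rw [hρ.sum_two_mul_outcomeProb] at hsum
  simp only [averageCapacity, hsum, Finset.mem_univ, true_imp_iff,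
    hρ.outcomeProb_mul_capacity_eq_iff]

lemma IsPureState.controlledCapacity_le_two (hρ : IsPureState ρ) : controlledCapacity ρ ≤ 2 :=
  ciSup_le fun _ => hρ.averageCapacity_le_two

lemma IsPureState.controlledCapacity_eq_two_iff (hρ : IsPureState ρ) :
    controlledCapacity ρ = 2 ↔ ∃ U, ∀ i,
      traceFst (unnormalizedPostState U ρ i) = (outcomeProb U ρ i / 2) • 1 := by
  simp only [← hρ.averageCapacity_eq_two_iff]
  obtain ⟨U, hmax, hU⟩ := exists_isMaxOn_averageCapacity ρ hρ.posSemidef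
  refine ⟨fun h => ⟨U, hU ▸ h⟩, fun ⟨V, hV⟩ => hρ.controlledCapacity_le_two.antisymm ?_⟩
  exact hU ▸ hV ▸ hmax.2 ⟨V, rfl⟩

lemma traceFst_sum {ι m n : Type*} [Fintype ι] [Fintype m] (A : ι → Matrix (m × n) (m × n) ℂ) :
    traceFst (∑ i, A i) = ∑ i, traceFst (A i) := by
  ext x y
  simp only [traceFst, Matrix.of_apply, Matrix.sum_apply]
  exact Finset.sum_comm

lemma IsPureState.traceFst_traceFst_of_controlledCapacity_eq_two (hρ : IsPureState ρ)
    (h : controlledCapacity ρ = 2) : traceFst (traceFst ρ) = (1 / 2 : ℝ) • 1 := by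
  obtain ⟨U, hU⟩ := hρ.controlledCapacity_eq_two_iff.1 h
  rw [← sum_unnormalizedPostState U, traceFst_sum, Finset.sum_congr rfl fun i _ => hU i,
    ← Finset.sum_smul, ← Finset.sum_div, sum_outcomeProb, hρ.trace_eq_one, Complex.one_re]

end Capacity

section Distribution

/-- The computational basis vector in which the qubits `σ 0`, `σ 1`, `σ 2` have the given
values. -/
def qubitEquiv (σ : Equiv.Perm (Fin 3)) : Fin 2 × (Fin 2 × Fin 2) ≃ (Fin 3 → Fin 2) where
  toFun p i := ![p.1, p.2.1, p.2.2] (σ.symm i)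
  invFun f := (f (σ 0), f (σ 1), f (σ 2))
  left_inv p := by simp
  right_inv f := by
    funext i
    obtain ⟨m, rfl⟩ := σ.surjective i
    fin_cases m <;> simp

/-- The reduced state of the receiver's qubit `σ 2`. -/
def receiverState (σ : Equiv.Perm (Fin 3)) (ρ : ThreeQubitOp) : Matrix (Fin 2) (Fin 2) ℂ :=
  traceFst (traceFst (distribute σ ρ))

variable (σ : Equiv.Perm (Fin 3)) {ρ : ThreeQubitOp}

lemma distribute_ketBra (ψ : (Fin 3 → Fin 2) → ℂ) :
    distribute σ (ketBra ψ) = ketBra (ψ ∘ qubitEquiv σ) := rfl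

lemma IsPureState.distribute (hρ : IsPureState ρ) : IsPureState (distribute σ ρ) := by
  obtain ⟨ψ, hψ, rfl⟩ := hρ
  exact ⟨ψ ∘ qubitEquiv σ, ((qubitEquiv σ).sum_comp fun f => ‖ψ f‖ ^ 2).trans hψ, rfl⟩

lemma qubitEquiv_mul_swap (a b c : Fin 2) :
    qubitEquiv (σ * Equiv.swap 0 2) (a, b, c) = qubitEquiv σ (c, b, a) := by
  refine (qubitEquiv σ).symm.injective ?_
  rw [Equiv.symm_apply_apply]
  simp [qubitEquiv, Equiv.Perm.mul_def, Equiv.swap_apply_of_ne_of_ne]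

lemma traceSnd_distribute (ρ : ThreeQubitOp) :
    traceSnd (distribute σ ρ) = receiverState (σ * Equiv.swap 0 2) ρ := by
  have hswap (p q) : distribute (σ * Equiv.swap 0 2) ρ p q =
      distribute σ ρ (p.2.2, p.2.1, p.1) (q.2.2, q.2.1, q.1) :=
    congrArg₂ ρ (qubitEquiv_mul_swap σ p.1 p.2.1 p.2.2) (qubitEquiv_mul_swap σ q.1 q.2.1 q.2.2)
  ext a b
  simp only [receiverState, traceSnd, traceFst, Matrix.of_apply, hswap, Fintype.sum_prod_type]

lemma controlPower_eq (hρ : IsPureState ρ) :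
    controlPower σ ρ = controlledCapacity (distribute σ ρ) -
      (1 + entropy (receiverState σ ρ) - entropy (receiverState (σ * Equiv.swap 0 2) ρ)) := by
  obtain ⟨ψ, -, rfl⟩ := hρ
  rw [controlPower, capacity, ← traceSnd_distribute, ← receiverState, ← ketBra, distribute_ketBra,
    entropy_traceFst_ketBra]

lemma controlPower_add_controlPower_mul_swap (hρ : IsPureState ρ) :
    controlPower σ ρ + controlPower (σ * Equiv.swap 0 2) ρ =
      controlledCapacity (distribute σ ρ) +
        controlledCapacity (distribute (σ * Equiv.swap 0 2) ρ) - 2 := by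
  rw [controlPower_eq _ hρ, controlPower_eq _ hρ, mul_assoc, Equiv.swap_mul_self, mul_one]
  ring

lemma receiverState_of_controlledCapacity_eq_two (hρ : IsPureState ρ)
    (h : controlledCapacity (distribute σ ρ) = 2) : receiverState σ ρ = (1 / 2 : ℝ) • 1 :=
  (hρ.distribute σ).traceFst_traceFst_of_controlledCapacity_eq_two h

end Distribution

section TracelessUnitary

variable {B : Matrix (Fin 2) (Fin 2) ℂ}

lemma norm_det_of_mem_unitaryGroup {n : Type*} [Fintype n] [DecidableEq n] {M : Matrix n n ℂ}
    (hM : M ∈ Matrix.unitaryGroup n ℂ) : ‖M.det‖ = 1 :=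
  CStarRing.norm_of_mem_unitary (Matrix.det_of_mem_unitary hM)

lemma mul_self_eq_neg_det_smul_one_of_trace_eq_zero (ht : B.trace = 0) : B * B = -B.det • 1 := by
  have hadj : B.adjugate = -B := by
    rw [Matrix.trace_fin_two] at ht
    ext i j
    fin_cases i <;> fin_cases j <;> simp [Matrix.adjugate_fin_two] <;> linear_combination ht
  rw [neg_smul, ← Matrix.mul_adjugate, hadj, mul_neg, neg_neg]

-- Dividing by a square root of `-det B` turns `B² = -det B` into `B² = 1`, and a unitary involution
-- is Hermitian.
lemma exists_isHermitian_inv_smul (hB : B ∈ Matrix.unitaryGroup (Fin 2) ℂ) (ht : B.trace = 0) :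
    ∃ μ : ℂ, μ ≠ 0 ∧ (μ⁻¹ • B).IsHermitian := by
  obtain ⟨μ, hμ⟩ := IsAlgClosed.exists_pow_nat_eq (-B.det) two_pos
  have hnorm : ‖μ‖ = 1 := by
    rw [← pow_eq_one_iff_of_nonneg (norm_nonneg μ) two_ne_zero, ← norm_pow, hμ, norm_neg,
      norm_det_of_mem_unitaryGroup hB]
  have hμ0 : μ ≠ 0 := norm_ne_zero_iff.1 (hnorm ▸ one_ne_zero)
  have hsq : B = μ ^ 2 • Bᴴ := by
    calc B = Bᴴ * (B * B) := by
          rw [← mul_assoc, ← Matrix.star_eq_conjTranspose, Matrix.mem_unitaryGroup_iff'.1 hB,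
            one_mul]
      _ = μ ^ 2 • Bᴴ := by
          rw [mul_self_eq_neg_det_smul_one_of_trace_eq_zero ht, ← hμ, mul_smul_comm, mul_one]
  refine ⟨μ, hμ0, ?_⟩
  calc (μ⁻¹ • B)ᴴ = μ • Bᴴ := by
        rw [Matrix.conjTranspose_smul, star_inv₀, Complex.star_def, ← Complex.inv_eq_conj hnorm,
          inv_inv]
    _ = μ⁻¹ • B := by
        conv_rhs => rw [hsq, smul_smul, pow_two, inv_mul_cancel_left₀ hμ0]

lemma exists_diagonalization_of_trace_eq_zero (hB : B ∈ Matrix.unitaryGroup (Fin 2) ℂ)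
    (ht : B.trace = 0) : ∃ (V : Matrix.unitaryGroup (Fin 2) ℂ) (e : ℂ), ‖e‖ = 1 ∧
      B = (V : Matrix (Fin 2) (Fin 2) ℂ) * Matrix.diagonal ![e, -e] *
        (V : Matrix (Fin 2) (Fin 2) ℂ)ᴴ := by
  obtain ⟨μ, hμ, hR⟩ := exists_isHermitian_inv_smul hB ht
  set V := hR.eigenvectorUnitary
  set d := hR.eigenvalues
  have hd1 : (d 1 : ℂ) = -d 0 := by
    have h := hR.trace_eq_sum_eigenvalues
    rw [Matrix.trace_smul, ht, smul_zero, Fin.sum_univ_two] at h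
    exact eq_neg_of_add_eq_zero_right h.symm
  have hdiag : μ • Matrix.diagonal (RCLike.ofReal ∘ d : Fin 2 → ℂ) =
      Matrix.diagonal ![μ * d 0, -(μ * d 0)] := by
    rw [← Matrix.diagonal_smul]
    congr 1
    ext i
    fin_cases i <;> simp [hd1]
  have hspec : B = (V : Matrix (Fin 2) (Fin 2) ℂ) * Matrix.diagonal ![μ * d 0, -(μ * d 0)] *
      (V : Matrix (Fin 2) (Fin 2) ℂ)ᴴ := by
    rw [← hdiag, Matrix.mul_smul, Matrix.smul_mul, ← Matrix.star_eq_conjTranspose,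
      ← Unitary.conjStarAlgAut_apply (S := ℂ), ← hR.spectral_theorem, smul_inv_smul₀ hμ]
  refine ⟨V, μ * d 0, ?_, hspec⟩
  have hdet : B.det = -(μ * d 0) ^ 2 := by
    rw [hspec, Matrix.det_mul_right_comm, ← Matrix.star_eq_conjTranspose,
      Matrix.mem_unitaryGroup_iff.1 V.2, one_mul, Matrix.det_diagonal, Fin.prod_univ_two]
    simp [pow_two]
  rw [← pow_eq_one_iff_of_nonneg (norm_nonneg _) two_ne_zero, ← norm_pow, ← norm_neg, ← hdet,
    norm_det_of_mem_unitaryGroup hB]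

end TracelessUnitary

section TwoUnitaries

lemma hadamardPhase_mem_unitaryGroup {e : ℂ} (he : ‖e‖ = 1) :
    (√2)⁻¹ • !![1, 1; e, -e] ∈ Matrix.unitaryGroup (Fin 2) ℂ := by
  have hphase : e * (starRingEnd ℂ) e = 1 := by simp [Complex.mul_conj', he]
  have hone : !![1, 1; e, -e] * (!![1, 1; e, -e])ᴴ = (2 : ℝ) • 1 := by
    ext i j
    fin_cases i <;> fin_cases j <;>
      simp [Matrix.mul_apply, Fin.sum_univ_two, hphase] <;> norm_num
  rw [Matrix.mem_unitaryGroup_iff, Matrix.star_eq_conjTranspose, Matrix.conjTranspose_smul,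
    star_trivial, smul_mul_smul_comm, hone, smul_smul, ← mul_inv,
    Real.mul_self_sqrt zero_le_two, inv_mul_cancel₀ two_ne_zero, one_smul]

lemma exists_simultaneous_diagonalization (X : Fin 2 → Matrix.unitaryGroup (Fin 2) ℂ)
    (h : ((X 0 : Matrix (Fin 2) (Fin 2) ℂ)ᴴ * (X 1 : Matrix (Fin 2) (Fin 2) ℂ)).trace = 0) :
    ∃ E P Q : Matrix.unitaryGroup (Fin 2) ℂ, ∀ i, (X i : Matrix (Fin 2) (Fin 2) ℂ) =
      √2 • ((P : Matrix (Fin 2) (Fin 2) ℂ) *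
        Matrix.diagonal ((E : Matrix (Fin 2) (Fin 2) ℂ) i) * (Q : Matrix (Fin 2) (Fin 2) ℂ)) := by
  obtain ⟨V, e, he, hV⟩ := exists_diagonalization_of_trace_eq_zero (star (X 0) * X 1).2 h
  refine ⟨⟨_, hadamardPhase_mem_unitaryGroup he⟩, X 0 * V, star V, fun i => ?_⟩
  have hrow : √2 • Matrix.diagonal (((√2)⁻¹ • !![1, 1; e, -e] : Matrix (Fin 2) (Fin 2) ℂ) i) =
      Matrix.diagonal (!![1, 1; e, -e] i) := by
    rw [← Matrix.diagonal_smul]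
    exact congrArg Matrix.diagonal (smul_inv_smul₀ (by positivity) _)
  rw [← Matrix.smul_mul, ← Matrix.mul_smul, hrow]
  fin_cases i
  · have hone : Matrix.diagonal ![(1 : ℂ), 1] = 1 := by
      rw [← Matrix.diagonal_one]
      exact congrArg Matrix.diagonal (funext fun t => by fin_cases t <;> rfl)
    change _ = _ * Matrix.diagonal ![1, 1] * _
    rw [hone, mul_one]
    exact congrArg Subtype.val (show X 0 = X 0 * V * star V by
      rw [mul_assoc, Unitary.mul_star_self, mul_one])
  · calc (X 1 : Matrix (Fin 2) (Fin 2) ℂ)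
        = (X 0 : Matrix (Fin 2) (Fin 2) ℂ) *
            ((star (X 0) * X 1 : Matrix.unitaryGroup (Fin 2) ℂ) : Matrix (Fin 2) (Fin 2) ℂ) :=
          congrArg Subtype.val (show X 1 = X 0 * (star (X 0) * X 1) by
            rw [← mul_assoc, Unitary.mul_star_self, one_mul])
      _ = (X 0 : Matrix (Fin 2) (Fin 2) ℂ) * (V : Matrix (Fin 2) (Fin 2) ℂ) *
            Matrix.diagonal ![e, -e] * (V : Matrix (Fin 2) (Fin 2) ℂ)ᴴ := by
          rw [hV, ← mul_assoc, ← mul_assoc]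

end TwoUnitaries

section GHZ

/-- The amplitudes of the image of the GHZ vector under `A ⊗ B ⊗ C`. -/
def ghzAmplitude (A B C : Matrix (Fin 2) (Fin 2) ℂ) (p : Fin 2 × (Fin 2 × Fin 2)) : ℂ :=
  (√2)⁻¹ • ∑ t, A p.1 t * B p.2.1 t * C p.2.2 t

lemma amplitudes_injective {m n : Type*} :
    Function.Injective (amplitudes : (m × n → ℂ) → Matrix m n ℂ) :=
  fun _ _ h => funext fun p => congrFun₂ h p.1 p.2

lemma trace_conjTranspose_amplitudes_mul_amplitudes {m n : Type*} [Fintype m] [Fintype n]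
    (φ χ : m × n → ℂ) : ((amplitudes φ)ᴴ * amplitudes χ).trace = χ ⬝ᵥ star φ := by
  simp only [Matrix.trace, Matrix.diag, Matrix.mul_apply, dotProduct, Fintype.sum_prod_type_right,
    mul_comm]
  rfl

section

variable (U : Matrix.unitaryGroup (Fin 2) ℂ)

lemma postVec_injective : Function.Injective (postVec U) := fun Φ Ψ h => by
  have hmul : (U : Matrix (Fin 2) (Fin 2) ℂ) * amplitudes Φ =
      (U : Matrix (Fin 2) (Fin 2) ℂ) * amplitudes Ψ := h
  refine amplitudes_injective ?_
  rw [← Matrix.one_mul (amplitudes Φ), ← Unitary.coe_star_mul_self U, Matrix.mul_assoc, hmul,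
    ← Matrix.mul_assoc, Unitary.coe_star_mul_self, Matrix.one_mul]

lemma postVec_dotProduct_star_postVec (Ψ : Fin 2 × (Fin 2 × Fin 2) → ℂ) (i j : Fin 2) :
    postVec U Ψ i ⬝ᵥ star (postVec U Ψ j) = ((U : Matrix (Fin 2) (Fin 2) ℂ) *
      traceSnd (ketBra Ψ) * (U : Matrix (Fin 2) (Fin 2) ℂ)ᴴ) i j := by
  rw [traceSnd_ketBra, ← Matrix.mul_assoc, Matrix.mul_assoc, ← Matrix.conjTranspose_mul]
  rfl

lemma mul_smul_one_mul_conjTranspose (c : ℝ) :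
    (U : Matrix (Fin 2) (Fin 2) ℂ) * c • 1 * (U : Matrix (Fin 2) (Fin 2) ℂ)ᴴ = c • 1 := by
  rw [mul_smul_comm, mul_one, smul_mul_assoc, ← Matrix.star_eq_conjTranspose,
    Matrix.mem_unitaryGroup_iff.1 U.2]

lemma amplitudes_postVec_ghzAmplitude (A B C : Matrix (Fin 2) (Fin 2) ℂ) (i : Fin 2) :
    amplitudes (postVec U (ghzAmplitude A B C) i) = (√2)⁻¹ •
      (B * Matrix.diagonal (((U : Matrix (Fin 2) (Fin 2) ℂ) * A) i) * Cᵀ) := by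
  ext b c
  rw [Matrix.smul_apply, Matrix.mul_apply]
  simp_rw [Matrix.mul_diagonal]
  simp only [postVec, amplitudes, ghzAmplitude, Matrix.of_apply, Matrix.mul_apply,
    Matrix.transpose_apply, Fin.sum_univ_two, Complex.real_smul]
  ring

end

lemma exists_unitary_amplitudes_postVec {Ψ : Fin 2 × (Fin 2 × Fin 2) → ℂ}
    (hΨ : IsPureState (ketBra Ψ)) (hmixed : traceSnd (ketBra Ψ) = (1 / 2 : ℝ) • 1)
    (hcap : controlledCapacity (ketBra Ψ) = 2) :
    ∃ (U : Matrix.unitaryGroup (Fin 2) ℂ) (X : Fin 2 → Matrix.unitaryGroup (Fin 2) ℂ),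
      (∀ i, (X i : Matrix (Fin 2) (Fin 2) ℂ) = (2 : ℝ) • amplitudes (postVec U Ψ i)) ∧
      ((X 0 : Matrix (Fin 2) (Fin 2) ℂ)ᴴ * (X 1 : Matrix (Fin 2) (Fin 2) ℂ)).trace = 0 := by
  obtain ⟨U, hU⟩ := hΨ.controlledCapacity_eq_two_iff.1 hcap
  have hprob (i) : outcomeProb U (ketBra Ψ) i = 1 / 2 := by
    rw [outcomeProb, hmixed, mul_smul_one_mul_conjTranspose]
    simp
  have hunitary (i) :
      (2 : ℝ) • amplitudes (postVec U Ψ i) ∈ Matrix.unitaryGroup (Fin 2) ℂ := by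
    have hgram := hU i
    rw [unnormalizedPostState_ketBra, traceFst_ketBra, hprob, ← Matrix.transpose_one,
      ← Matrix.transpose_smul, Matrix.transpose_inj] at hgram
    rw [Matrix.mem_unitaryGroup_iff', Matrix.star_eq_conjTranspose, Matrix.conjTranspose_smul,
      star_trivial, smul_mul_smul_comm, hgram, smul_smul]
    norm_num
  refine ⟨U, fun i => ⟨_, hunitary i⟩, fun i => rfl, ?_⟩
  rw [Matrix.conjTranspose_smul, smul_mul_smul_comm, Matrix.trace_smul,
    trace_conjTranspose_amplitudes_mul_amplitudes, postVec_dotProduct_star_postVec, hmixed,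
    mul_smul_one_mul_conjTranspose]
  simp

lemma exists_eq_ghzAmplitude {Ψ : Fin 2 × (Fin 2 × Fin 2) → ℂ}
    (hΨ : IsPureState (ketBra Ψ)) (hmixed : traceSnd (ketBra Ψ) = (1 / 2 : ℝ) • 1)
    (hcap : controlledCapacity (ketBra Ψ) = 2) :
    ∃ A B C : Matrix.unitaryGroup (Fin 2) ℂ, Ψ = ghzAmplitude A B C := by
  obtain ⟨U, X, hX, horth⟩ := exists_unitary_amplitudes_postVec hΨ hmixed hcap
  obtain ⟨E, P, Q, hEPQ⟩ := exists_simultaneous_diagonalization X horth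
  have hUE : (U : Matrix (Fin 2) (Fin 2) ℂ) *
      ((star U * E : Matrix.unitaryGroup (Fin 2) ℂ) : Matrix (Fin 2) (Fin 2) ℂ) = E :=
    congrArg Subtype.val (show U * (star U * E) = E by
      rw [← mul_assoc, Unitary.mul_star_self, one_mul])
  refine ⟨star U * E, P, ⟨_, Matrix.transpose_mem_unitaryGroup_iff.2 Q.2⟩, postVec_injective U ?_⟩
  funext i
  refine amplitudes_injective (smul_right_injective _ (two_ne_zero (α := ℝ)) ?_)
  change (2 : ℝ) • _ = (2 : ℝ) • _
  rw [← hX, hEPQ, amplitudes_postVec_ghzAmplitude, hUE, smul_smul, Matrix.transpose_transpose,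
    ← div_eq_mul_inv, Real.div_sqrt]

section

variable (A B C : Matrix.unitaryGroup (Fin 2) ℂ)

lemma exists_traceFst_unnormalizedPostState_ghzAmplitude :
    ∃ U, ∀ i, traceFst (unnormalizedPostState U (ketBra (ghzAmplitude A B C)) i) =
      (1 / 4 : ℝ) • 1 := by
  let H : Matrix.unitaryGroup (Fin 2) ℂ := ⟨_, hadamardPhase_mem_unitaryGroup norm_one⟩
  refine ⟨H * star A, fun i => ?_⟩
  have hHA : ((H * star A : Matrix.unitaryGroup (Fin 2) ℂ) : Matrix (Fin 2) (Fin 2) ℂ) * A = H :=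
    congrArg Subtype.val (show H * star A * A = H by
      rw [mul_assoc, Unitary.star_mul_self, mul_one])
  set D := Matrix.diagonal ((H : Matrix (Fin 2) (Fin 2) ℂ) i)
  have hD : Dᴴ * D = (1 / 2 : ℝ) • 1 := by
    rw [Matrix.diagonal_conjTranspose, Matrix.diagonal_mul_diagonal, ← Matrix.diagonal_one,
      ← Matrix.diagonal_smul]
    congr 1
    funext t
    fin_cases i <;> fin_cases t <;> simp [H, ← mul_inv, ← Complex.ofReal_mul]
  have hB : (B : Matrix (Fin 2) (Fin 2) ℂ)ᴴ * B = 1 := Matrix.mem_unitaryGroup_iff'.1 B.2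
  have hC : (C : Matrix (Fin 2) (Fin 2) ℂ)ᵀᴴ * (C : Matrix (Fin 2) (Fin 2) ℂ)ᵀ = 1 :=
    Matrix.mem_unitaryGroup_iff'.1 (Matrix.transpose_mem_unitaryGroup_iff.2 C.2)
  have hgram : ((B : Matrix (Fin 2) (Fin 2) ℂ) * D * (C : Matrix (Fin 2) (Fin 2) ℂ)ᵀ)ᴴ *
      ((B : Matrix (Fin 2) (Fin 2) ℂ) * D * (C : Matrix (Fin 2) (Fin 2) ℂ)ᵀ) =
      (1 / 2 : ℝ) • 1 := by
    rw [Matrix.conjTranspose_mul, Matrix.conjTranspose_mul]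
    calc _ = (C : Matrix (Fin 2) (Fin 2) ℂ)ᵀᴴ * (Dᴴ * ((B : Matrix (Fin 2) (Fin 2) ℂ)ᴴ * B) * D) *
          (C : Matrix (Fin 2) (Fin 2) ℂ)ᵀ := by simp only [mul_assoc]
      _ = (1 / 2 : ℝ) • 1 := by
        rw [hB, mul_one, hD, mul_smul_comm, mul_one, smul_mul_assoc, hC]
  rw [unnormalizedPostState_ketBra, traceFst_ketBra, amplitudes_postVec_ghzAmplitude, hHA,
    Matrix.conjTranspose_smul, star_trivial, smul_mul_smul_comm, hgram, smul_smul, ← mul_inv,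
    Real.mul_self_sqrt zero_le_two, Matrix.transpose_smul, Matrix.transpose_one]
  norm_num

lemma sum_norm_sq_ghzAmplitude : ∑ p, ‖ghzAmplitude A B C p‖ ^ 2 = 1 := by
  obtain ⟨U, hU⟩ := exists_traceFst_unnormalizedPostState_ghzAmplitude A B C
  have hsum := sum_outcomeProb U (ketBra (ghzAmplitude A B C))
  simp only [← trace_traceFst_unnormalizedPostState, hU, trace_ketBra, Complex.ofReal_re] at hsum
  norm_num [← hsum]

lemma controlledCapacity_ghzAmplitude :
    controlledCapacity (ketBra (ghzAmplitude A B C)) = 2 := by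
  have hpure : IsPureState (ketBra (ghzAmplitude A B C)) :=
    ⟨_, sum_norm_sq_ghzAmplitude A B C, rfl⟩
  obtain ⟨U, hU⟩ := exists_traceFst_unnormalizedPostState_ghzAmplitude A B C
  refine hpure.controlledCapacity_eq_two_iff.2 ⟨U, fun i => ?_⟩
  rw [← trace_traceFst_unnormalizedPostState, hU]
  congr 1
  simp

end

end GHZ

section GHZOrbit

variable (U : Fin 3 → Matrix.unitaryGroup (Fin 2) ℂ) (σ : Equiv.Perm (Fin 3))

lemma localUnitary_mulVec_ghzVector (f : Fin 3 → Fin 2) :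
    (localUnitary U *ᵥ ghzVector) f =
      (√2)⁻¹ • ∑ t, ∏ i, (U i : Matrix (Fin 2) (Fin 2) ℂ) (f i) t := by
  simp [ghzVector, Matrix.mulVec_smul, Matrix.mulVec_add, localUnitary, Fin.sum_univ_two]

lemma localUnitary_mul_ghzState_mul_conjTranspose :
    localUnitary U * ghzState * (localUnitary U)ᴴ = ketBra (localUnitary U *ᵥ ghzVector) :=
  mul_ketBra_mul_conjTranspose _ _

lemma localUnitary_mulVec_ghzVector_comp_qubitEquiv :
    (localUnitary U *ᵥ ghzVector) ∘ qubitEquiv σ =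
      ghzAmplitude (U (σ 0)) (U (σ 1)) (U (σ 2)) := by
  funext p
  rw [Function.comp_apply, localUnitary_mulVec_ghzVector, ghzAmplitude]
  congr 2
  funext t
  rw [← Equiv.prod_comp σ, Fin.prod_univ_three]
  simp [qubitEquiv]

lemma isPureState_localUnitary_mul_ghzState :
    IsPureState (localUnitary U * ghzState * (localUnitary U)ᴴ) := by
  refine ⟨_, ?_, localUnitary_mul_ghzState_mul_conjTranspose U⟩
  have hnorm := sum_norm_sq_ghzAmplitude (U 0) (U 1) (U 2)
  rw [← (qubitEquiv 1).sum_comp, ← hnorm]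
  exact Finset.sum_congr rfl fun p _ => congrArg (fun z : ℂ => ‖z‖ ^ 2)
    (congrFun (localUnitary_mulVec_ghzVector_comp_qubitEquiv U 1) p)

lemma controlledCapacity_distribute_localUnitary_mul_ghzState :
    controlledCapacity (distribute σ (localUnitary U * ghzState * (localUnitary U)ᴴ)) = 2 := by
  rw [localUnitary_mul_ghzState_mul_conjTranspose, distribute_ketBra,
    localUnitary_mulVec_ghzVector_comp_qubitEquiv, controlledCapacity_ghzAmplitude]

lemma controlPower_localUnitary_mul_ghzState :
    controlPower σ (localUnitary U * ghzState * (localUnitary U)ᴴ) = 1 := by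
  have hpure := isPureState_localUnitary_mul_ghzState U
  have hcap (τ) := controlledCapacity_distribute_localUnitary_mul_ghzState U τ
  have hmixed (τ) := receiverState_of_controlledCapacity_eq_two τ hpure (hcap τ)
  rw [controlPower_eq σ hpure, hcap, hmixed, hmixed]
  norm_num

variable {σ}

lemma exists_localUnitary_of_one_le_controlPower {ρ : ThreeQubitOp} (hρ : IsPureState ρ)
    (h : 1 ≤ controlPower σ ρ) (hswap : 1 ≤ controlPower (σ * Equiv.swap 0 2) ρ) :
    ∃ U, ρ = localUnitary U * ghzState * (localUnitary U)ᴴ := by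
  have hadd := controlPower_add_controlPower_mul_swap σ hρ
  have hpure := hρ.distribute σ
  have hle := hpure.controlledCapacity_le_two
  have hle_swap := (hρ.distribute (σ * Equiv.swap 0 2)).controlledCapacity_le_two
  have hmixed : traceSnd (distribute σ ρ) = (1 / 2 : ℝ) • 1 := by
    rw [traceSnd_distribute]
    exact receiverState_of_controlledCapacity_eq_two _ hρ (by linarith)
  have hcap : controlledCapacity (distribute σ ρ) = 2 := by linarith
  obtain ⟨ψ, -, rfl⟩ := hρ
  obtain ⟨A, B, C, hABC⟩ := exists_eq_ghzAmplitude (Ψ := ψ ∘ qubitEquiv σ) hpure hmixed hcap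
  let U : Fin 3 → Matrix.unitaryGroup (Fin 2) ℂ := ![A, B, C] ∘ σ.symm
  have hU : ghzAmplitude (U (σ 0)) (U (σ 1)) (U (σ 2)) = ghzAmplitude A B C := by simp [U]
  have hψ : ψ = localUnitary U *ᵥ ghzVector :=
    (qubitEquiv σ).surjective.injective_comp_right <|
      hABC.trans ((localUnitary_mulVec_ghzVector_comp_qubitEquiv U σ).trans hU).symm
  exact ⟨U, by rw [localUnitary_mul_ghzState_mul_conjTranspose, ← hψ, ketBra]⟩

end GHZOrbit

end ControlledDenseCoding

end

theorem proposition4 (ρ : ControlledDenseCoding.ThreeQubitOp)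
    (hρ : ControlledDenseCoding.IsPureState ρ) :
    ControlledDenseCoding.minimalControlPower ρ = 1 ↔
      ∃ U : Fin 3 → Matrix.unitaryGroup (Fin 2) ℂ,
        ρ = ControlledDenseCoding.localUnitary U * ControlledDenseCoding.ghzState *
          (ControlledDenseCoding.localUnitary U)ᴴ := by
  open ControlledDenseCoding in
  constructor
  · intro h
    have hle (σ) : 1 ≤ controlPower σ ρ := h ▸ Finset.inf'_le _ (Finset.mem_univ σ)
    exact exists_localUnitary_of_one_le_controlPower hρ (hle 1) (hle _)
  · rintro ⟨U, rfl⟩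
    simp only [minimalControlPower, controlPower_localUnitary_mul_ghzState, Finset.inf'_const]
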